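/- Let $(X,m)$ and $(Y,\nu)$ each be the unit interval with Lebesgue measure, and let $(Z,\mu)=(X\times Y,\,m\times\nu)$. For $W\in\{X,Z\}$ let $\mathcal G(W)$ be the set of invertible measure-preserving transformations of $W$, modulo almost everywhere equality, with the weak topology, i.e. the topology with subbasic open sets $\{S : \operatorname{vol}(SA\,\triangle\,TA)<\varepsilon\}$, where $T\in\mathcal G(W)$, $A\subset W$ is measurable, $\varepsilon>0$, and $\operatorname{vol}$ is the measure of $W$. A transformation acts on functions by $Tf=f\circ T$. For $T_0\in\mathcal G(X)$ let $\mathcal G_{T_0}\subset\mathcal G(Z)$, with the subspace topology, be the set of extensions of $T_0$ through the projection $\pi:Z\to X$, i.e. of those $T$ with $\pi\circ T=T_0\circ\pi$ almost everywhere. Let $L^2(Z|X)$ be the set of complex-valued $f\in L^2(Z)$ with $\mathbb E(|f|^2\,|\,X)\in L^\infty(X)$. A transformation $T\in\mathcal G_{T_0}$ is a strongly mixing extension of $T_0$ if for all $f,g\in L^2(Z|X)$ $$\lim_{n\to\infty}\bigl\|\mathbb E(T^n f\cdot\overline g\,|\,X)-T_0^n\,\mathbb E(f|X)\cdot\mathbb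 E(\overline g|X)\bigr\|_{L^2(X)}=0 .$$ Let $\mathcal S_{T_0}\subset\mathcal G_{T_0}$ be the set of strongly mixing extensions of $T_0$. **Theorem.** Let $T_0\in\mathcal G(X)$ be antiperiodic (the set of periodic points of $T_0$ has measure zero) and rigid (there are positive integers $n_1<n_2<\cdots$ such that $\|T_0^{n_k}f-f\|_{L^2(X)}\to0$ for every $f\in L^2(X)$). Then $\mathcal S_{T_0}$ is a first category (meagre) subset of $\mathcal G_{T_0}$. -/

import Mathlib

open MeasureTheory Filter Topology
open scoped ENNReal symmDiff

noncomputable section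

namespace SkewExt

/-- An invertible measure-preserving transformation of `α` (a point map). -/
structure MPTrans (α : Type) [MeasureSpace α] where
  /-- the underlying bimeasurable bijection -/
  toEquiv : α ≃ᵐ α
  measurePreserving : MeasurePreserving toEquiv volume volume

instance {α : Type} [MeasureSpace α] : CoeFun (MPTrans α) (fun _ => α → α) :=
  ⟨fun T => T.toEquiv⟩

/-- Two transformations are identified when they agree almost everywhere. -/
instance aeSetoid (α : Type) [MeasureSpace α] : Setoid (MPTrans α) where
  r S T := S =ᵐ[volume] T
  iseqv := ⟨fun _ => EventuallyEq.rfl, fun h => h.symm, fun h h' => h.trans h'⟩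

/-- The weak topology on point maps: the topology whose subbasic open sets are
`{S | vol (S A ∆ T A) < ε}`, for `T` a transformation, `A` a measurable set and `ε > 0`. -/
instance weakTopology (α : Type) [MeasureSpace α] : TopologicalSpace (MPTrans α) :=
  TopologicalSpace.generateFrom
    {U | ∃ (T : MPTrans α) (A : Set α) (ε : ℝ≥0∞), MeasurableSet A ∧ 0 < ε ∧
      U = {S : MPTrans α | volume ((S '' A) ∆ (T '' A)) < ε}}

/-- The space `𝒢(α)` of invertible measure-preserving transformations of `α` modulo almost
everywhere equality. -/
def 𝒢 (α : Type) [MeasureSpace α] : Type := Quotient (aeSetoid α)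

/-- The weak topology on `𝒢(α)`. The subbasic sets of `weakTopology` are unions of classes, so
their images form a subbasis of this quotient topology. -/
instance (α : Type) [MeasureSpace α] : TopologicalSpace (𝒢 α) :=
  inferInstanceAs (TopologicalSpace (Quotient (aeSetoid α)))

theorem iterate_ae_eq {α : Type} [MeasureSpace α] {S T : MPTrans α}
    (h : S =ᵐ[volume] T) (n : ℕ) : (S : α → α)^[n] =ᵐ[volume] (T : α → α)^[n] := by
  induction n with
  | zero => exact EventuallyEq.rfl
  | succ n ih =>
    have h1 := T.measurePreserving.quasiMeasurePreserving.ae_eq_comp ih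
    filter_upwards [h, h1] with x hx hx1
    simp only [Function.iterate_succ, Function.comp_apply] at hx1 ⊢
    rw [hx, hx1]

/-- The set of periodic points of the point map `T` is null. -/
def MPTrans.Antiperiodic {α : Type} [MeasureSpace α] (T : MPTrans α) : Prop :=
  volume (Function.periodicPts (T : α → α)) = 0

/-- For some strictly increasing sequence `n_k`, the Koopman operators satisfy `T^{n_k} → 1`
strongly on the complex space `L²(α)`. -/
def MPTrans.Rigid {α : Type} [MeasureSpace α] (T : MPTrans α) : Prop :=
  ∃ n : ℕ → ℕ, StrictMono n ∧ ∀ f : α → ℂ, MemLp f 2 volume →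
    Tendsto (fun k => eLpNorm (fun x => f ((T : α → α)^[n k] x) - f x) 2 volume) atTop (𝓝 0)

theorem MPTrans.Antiperiodic.congr {α : Type} [MeasureSpace α] {S T : MPTrans α}
    (h : S =ᵐ[volume] T) (hS : S.Antiperiodic) : T.Antiperiodic := by
  have h1 : ∀ᵐ x, ∀ n, (S : α → α)^[n] x = (T : α → α)^[n] x :=
    ae_all_iff.2 fun n => iterate_ae_eq h n
  have h2 : ∀ᵐ x, x ∉ Function.periodicPts (S : α → α) := measure_eq_zero_iff_ae_notMem.1 hS
  refine measure_eq_zero_iff_ae_notMem.2 ?_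
  filter_upwards [h1, h2] with x hx hx2 hp
  obtain ⟨n, hn, hpn⟩ := hp
  exact hx2 ⟨n, hn, (hx n).trans hpn⟩

theorem MPTrans.Rigid.congr {α : Type} [MeasureSpace α] {S T : MPTrans α}
    (h : S =ᵐ[volume] T) (hS : S.Rigid) : T.Rigid := by
  obtain ⟨n, hn, H⟩ := hS
  refine ⟨n, hn, fun f hf => (H f hf).congr fun k => eLpNorm_congr_ae ?_⟩
  filter_upwards [iterate_ae_eq h (n k)] with x hx
  rw [hx]

/-- Antiperiodicity of an element of `𝒢(α)`. -/
def Antiperiodic {α : Type} [MeasureSpace α] (T : 𝒢 α) : Prop :=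
  Quotient.liftOn T MPTrans.Antiperiodic
    fun _ _ h => propext ⟨fun H => H.congr h, fun H => H.congr h.symm⟩

/-- Rigidity of an element of `𝒢(α)`. -/
def Rigid {α : Type} [MeasureSpace α] (T : 𝒢 α) : Prop :=
  Quotient.liftOn T MPTrans.Rigid
    fun _ _ h => propext ⟨fun H => H.congr h, fun H => H.congr h.symm⟩

/-- `X`: the unit interval with Lebesgue measure. -/
abbrev X : Type := unitInterval

/-- `Y`: the unit interval with Lebesgue measure. -/
abbrev Y : Type := unitInterval

/-- `Z = X × Y` with the product measure. -/
abbrev Z : Type := X × Y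

/-- The σ-algebra on `Z` generated by the projection to `X`. -/
abbrev sigmaX : MeasurableSpace Z := MeasurableSpace.comap Prod.fst inferInstance

/-- The conditional expectation `E(f | X)`, as a `sigmaX`-measurable function on `Z`. -/
def condX {E : Type} [NormedAddCommGroup E] [NormedSpace ℝ E] [CompleteSpace E] (f : Z → E) :
    Z → E :=
  volume[f | sigmaX]

/-- `f ∈ L²(Z|X)`: `f ∈ L²(Z)` and `E(|f|² | X)` is essentially bounded. -/
def MemL2Rel (f : Z → ℂ) : Prop :=
  MemLp f 2 volume ∧ ∃ C : ℝ, ∀ᵐ z, condX (fun w => ‖f w‖ ^ 2) z ≤ C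

/-- The point map `T` on `Z` extends `T₀` through the projection onto `X`. -/
def MPTrans.Extends (T₀ : MPTrans X) (T : MPTrans Z) : Prop :=
  (fun z => (T z).1) =ᵐ[volume] fun z : Z => T₀ z.1

/-- `‖E(Tⁿ f · conj g | X) - T₀ⁿ E(f | X) · E(conj g | X)‖₂ → 0` for all `f, g ∈ L²(Z|X)`.
Here `T₀` acts on functions on `Z` as `T₀ × 1`, and the `L²(X)`-norm is computed as the
`L²(Z)`-norm of a function that depends only on the first coordinate. -/
def MPTrans.MixingRel (T₀ : MPTrans X) (T : MPTrans Z) : Prop :=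
  ∀ f g : Z → ℂ, MemL2Rel f → MemL2Rel g →
    Tendsto (fun n : ℕ => eLpNorm (fun z : Z =>
        condX (fun w => f ((T : Z → Z)^[n] w) * starRingEnd ℂ (g w)) z
          - condX f ((T₀ : X → X)^[n] z.1, z.2) * condX (fun w => starRingEnd ℂ (g w)) z)
        2 volume)
      atTop (𝓝 0)

theorem ae_fst {p : X → Prop} (h : ∀ᵐ x, p x) : ∀ᵐ z : Z, p z.1 :=
  (Measure.quasiMeasurePreserving_fst (μ := (volume : Measure X))
    (ν := (volume : Measure Y))).ae h

theorem MPTrans.Extends.congr {S₀ T₀ : MPTrans X} {S T : MPTrans Z} (h₀ : S₀ =ᵐ[volume] T₀)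
    (h : S =ᵐ[volume] T) (H : S₀.Extends S) : T₀.Extends T := by
  unfold MPTrans.Extends at H ⊢
  filter_upwards [ae_fst h₀, h, H] with z h1 h2 h3
  rw [← h2, h3, h1]

theorem MPTrans.MixingRel.congr {S₀ T₀ : MPTrans X} {S T : MPTrans Z} (h₀ : S₀ =ᵐ[volume] T₀)
    (h : S =ᵐ[volume] T) (H : S₀.MixingRel S) : T₀.MixingRel T := by
  intro f g hf hg
  refine (H f g hf hg).congr fun n => eLpNorm_congr_ae ?_
  have h1 : (fun w => f ((S : Z → Z)^[n] w) * starRingEnd ℂ (g w)) =ᵐ[volume]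
      fun w => f ((T : Z → Z)^[n] w) * starRingEnd ℂ (g w) := by
    filter_upwards [iterate_ae_eq h n] with w hw
    rw [hw]
  filter_upwards [ae_fst (iterate_ae_eq h₀ n), condExp_congr_ae (m := sigmaX) h1] with z h2 h3
  rw [h2]
  simp only [condX]
  rw [h3]

/-- `T ∈ 𝒢(Z)` is an extension of `T₀ ∈ 𝒢(X)` through the projection onto `X`. -/
def Extends (T₀ : 𝒢 X) (T : 𝒢 Z) : Prop :=
  Quotient.liftOn₂ T₀ T MPTrans.Extends
    fun _ _ _ _ h₀ h => propext ⟨fun H => H.congr h₀ h, fun H => H.congr h₀.symm h.symm⟩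

/-- The asymptotic condition defining strongly mixing extensions, on classes. -/
def MixingRel (T₀ : 𝒢 X) (T : 𝒢 Z) : Prop :=
  Quotient.liftOn₂ T₀ T MPTrans.MixingRel
    fun _ _ _ _ h₀ h => propext ⟨fun H => H.congr h₀ h, fun H => H.congr h₀.symm h.symm⟩

/-- `𝒢_{T₀}`: the space of extensions of `T₀`, with the weak topology (the subspace topology
from `𝒢(Z)`). -/
abbrev ExtSpace (T₀ : 𝒢 X) : Type := {T : 𝒢 Z // Extends T₀ T}

/-- `𝒮_{T₀}`: the set of strongly mixing extensions of `T₀`, as a subset of `𝒢_{T₀}`. -/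
def mixingExtensions (T₀ : 𝒢 X) : Set (ExtSpace T₀) := {T | MixingRel T₀ T.1}

end SkewExt

end

/-!
The argument is a relative version of Rokhlin's proof that strong mixing is a meagre property.

Let `A = X × [0, 1/2]`. If `T` is a strongly mixing extension, the relative correlations of the
indicator of `A` converge to `1/4`, so `vol (A ∩ T⁻ⁿ A) → 1/4` and these overlaps eventually stay
at most `3/8` (`MPTrans.MixingRel.exists_notMem_overlapSet`). Hence `T` misses one of the sets
`overlapSet A (3/8) N` of transformations whose overlap exceeds `3/8` at some time `n ≥ N`. These
sets are open (`isOpen_overlapSet`), and it remains to see that they are dense among the extensions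
of `T₀`.

Density comes from the conjugates `S (T₀ × 1) S⁻¹` with `S` acting in the fibres. Since `T₀` is
rigid, so is `T₀ × 1`, and under a conjugate of it the overlaps of `A` come arbitrarily close to
`vol A = 1/2` at arbitrarily late times (`conj_prodId_mem_overlapSet`). Since `T₀` is antiperiodic,
such conjugates come uniformly close to any given extension `T`
(`MPTrans.Extends.exists_conj_prodId_close`). For this one needs a function `j : X → ℕ` with
`j (T₀ x) = j x + 1` off a set of small measure (`exists_tower_height`): conjugating over `x` by
`T ^ j(x) (T₀ × 1) ^ (-j(x))` turns `T₀ × 1` into `T` over all such `x`. The function `j` is the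
time since the last visit to a small set met by almost every orbit (`exists_marker`).
-/

namespace SkewExt

open Set

/-! ### Markers and towers for antiperiodic transformations -/

/-- A marker set: a set of small measure which is visited by almost every forward orbit of an
antiperiodic transformation.

With `N > 1 / ε`, countably many sets `D i`, each disjoint from its first `N - 1` preimages,
cover the aperiodic points. A point `x` is put into `B` when it lies in the first `D i` that the
orbit of `x` visits infinitely often. The index of that `D i` is constant along orbits, so `B` is
also disjoint from its first `N - 1` preimages. By Poincaré recurrence almost every `x` has such
a `D i`, and its orbit then meets `B`. -/
theorem exists_marker {α : Type*} [TopologicalSpace α] [T1Space α] [SecondCountableTopology α]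
    [MeasurableSpace α] [OpensMeasurableSpace α] {μ : Measure α} [IsProbabilityMeasure μ]
    {τ : α → α} (hτ : MeasurePreserving τ μ μ) (hper : μ (Function.periodicPts τ) = 0)
    {ε : ℝ≥0∞} (hε : ε ≠ 0) :
    ∃ B : Set α, MeasurableSet B ∧ μ B < ε ∧ ∀ᵐ x ∂μ, ∃ n, τ^[n] x ∈ B := by
  obtain ⟨N, hN⟩ := ENNReal.exists_inv_nat_lt hε
  obtain ⟨x₀⟩ : Nonempty α := nonempty_of_isProbabilityMeasure μ
  obtain ⟨V₀, hV₀, -⟩ := (TopologicalSpace.isBasis_countableBasis α).exists_subset_of_mem_open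
    (mem_univ x₀) isOpen_univ
  obtain ⟨U, hU⟩ := (TopologicalSpace.countable_countableBasis α).exists_eq_range
    ⟨V₀, hV₀⟩
  have hbasis : TopologicalSpace.IsTopologicalBasis (range U) :=
    hU ▸ TopologicalSpace.isBasis_countableBasis α
  have hUo : ∀ i, IsOpen (U i) := fun i => hbasis.isOpen (mem_range_self i)
  let D : ℕ → Set α := fun i => U i ∩ ⋂ k, ⋂ _ : 1 ≤ k, ⋂ _ : k < N, (τ^[k] ⁻¹' U i)ᶜ
  have hD : ∀ i x, x ∈ D i ↔ x ∈ U i ∧ ∀ k, 1 ≤ k → k < N → τ^[k] x ∉ U i := by simp [D]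
  have hDm : ∀ i, MeasurableSet (D i) := fun i =>
    (hUo i).measurableSet.inter <| MeasurableSet.iInter fun k => MeasurableSet.iInter fun _ =>
      MeasurableSet.iInter fun _ => ((hτ.iterate k).measurable (hUo i).measurableSet).compl
  have hDcov : ∀ x, x ∉ Function.periodicPts τ → ∃ i, x ∈ D i := by
    intro x hx
    have hopen : IsOpen ((fun k => τ^[k] x) '' (Ico 1 N))ᶜ :=
      ((finite_Ico 1 N).image _).isClosed.isOpen_compl
    have hmem : x ∈ ((fun k => τ^[k] x) '' (Ico 1 N))ᶜ := by
      rintro ⟨k, hk, hkx⟩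
      exact hx ⟨k, hk.1, hkx⟩
    obtain ⟨_, ⟨i, rfl⟩, hxi, hsub⟩ := hbasis.exists_subset_of_mem_open hmem hopen
    refine ⟨i, (hD i x).2 ⟨hxi, fun k h1 h2 hk => hsub hk ⟨k, ⟨h1, h2⟩, rfl⟩⟩⟩
  let F : ℕ → Set α := fun i => {x | ∃ᶠ n in atTop, τ^[n] x ∈ D i}
  have hFm : ∀ i, MeasurableSet (F i) := fun i => by
    have : F i = ⋂ a, ⋃ b, ⋃ _ : a ≤ b, τ^[b] ⁻¹' D i := by
      ext
      simp [F, frequently_atTop]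
    exact this ▸ MeasurableSet.iInter fun a => MeasurableSet.iUnion fun b =>
      MeasurableSet.iUnion fun _ => (hτ.iterate b).measurable (hDm i)
  have hFinv : ∀ i n x, τ^[n] x ∈ F i ↔ x ∈ F i := by
    intro i n x
    change (∃ᶠ m in atTop, τ^[m] (τ^[n] x) ∈ D i) ↔ ∃ᶠ m in atTop, τ^[m] x ∈ D i
    conv_rhs => rw [← map_add_atTop_eq_nat n, frequently_map]
    simp only [Function.iterate_add_apply]
  let B : Set α := {x | ∃ i, x ∈ D i ∧ x ∈ F i ∧ ∀ l < i, x ∉ F l}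
  have hBm : MeasurableSet B := by
    have : B = ⋃ i, D i ∩ (F i ∩ ⋂ l, ⋂ _ : l < i, (F l)ᶜ) := by
      ext; simp [B]
    exact this ▸ MeasurableSet.iUnion fun i => (hDm i).inter <| (hFm i).inter <|
      MeasurableSet.iInter fun l => MeasurableSet.iInter fun _ => (hFm l).compl
  have hBdisj : ∀ x k, 1 ≤ k → k < N → x ∈ B → τ^[k] x ∉ B := by
    rintro x k h1 h2 ⟨i, hi, hFi, hil⟩ ⟨l, hl, hFl, hli⟩
    simp only [hFinv] at hFl hli
    obtain h | rfl | h := lt_trichotomy i l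
    · exact hli i h hFi
    · exact ((hD _ _).1 hi).2 k h1 h2 ((hD _ _).1 hl).1
    · exact hil l h hFl
  refine ⟨B, hBm, ?_, ?_⟩
  -- `B` and its first `N - 1` preimages are disjoint, so `N * μ B ≤ 1`.
  · by_contra! hle
    have hlt : μ univ < ∑ k ∈ Finset.range N, μ (τ^[k] ⁻¹' B) := by
      simp only [fun k => (hτ.iterate k).measure_preimage hBm.nullMeasurableSet, measure_univ,
        Finset.sum_const, Finset.card_range, nsmul_eq_mul]
      have hN0 : (N : ℝ≥0∞) ≠ 0 := by
        rintro h
        simp [h] at hN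
      calc (1 : ℝ≥0∞) = N * (N : ℝ≥0∞)⁻¹ :=
            (ENNReal.mul_inv_cancel hN0 (ENNReal.natCast_ne_top N)).symm
        _ < N * μ B := (ENNReal.mul_lt_mul_iff_right hN0 (ENNReal.natCast_ne_top N)).2
            (hN.trans_le hle)
    obtain ⟨a, ha, b, hb, hab, y, hya, hyb⟩ := exists_nonempty_inter_of_measure_univ_lt_sum_measure
      μ (fun k _ => ((hτ.iterate k).measurable hBm).nullMeasurableSet) hlt
    simp only [Finset.mem_range] at ha hb
    wlog h : a < b generalizing a b
    · exact this b a hab.symm hyb hya hb ha (lt_of_le_of_ne (not_lt.1 h) hab.symm)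
    refine hBdisj (τ^[a] y) (b - a) (by omega) (by omega) hya ?_
    rw [← Function.iterate_add_apply, Nat.sub_add_cancel h.le]
    exact hyb
  -- By recurrence an orbit starting in `D i` visits `D i` infinitely often.
  · have hrec : ∀ᵐ x ∂μ, ∀ i, x ∈ D i → x ∈ F i := ae_all_iff.2 fun i =>
      hτ.conservative.ae_mem_imp_frequently_image_mem (hDm i).nullMeasurableSet
    filter_upwards [hrec, measure_eq_zero_iff_ae_notMem.1 hper] with x hx hxp
    classical
    obtain ⟨i, hi⟩ := hDcov x hxp
    have hex : ∃ i, x ∈ F i := ⟨i, hx i hi⟩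
    obtain ⟨n, hn⟩ := (Nat.find_spec hex).exists
    exact ⟨n, Nat.find hex, hn, (hFinv _ _ _).2 (Nat.find_spec hex),
      fun l hl h => Nat.find_min hex hl ((hFinv _ _ _).1 h)⟩

/-- The inverse of a measure-preserving transformation. -/
def MPTrans.symm {α : Type} [MeasureSpace α] (T : MPTrans α) : MPTrans α :=
  ⟨T.toEquiv.symm, T.measurePreserving.symm⟩

/-- The composition of two measure-preserving transformations, the left one acting first. -/
def MPTrans.trans {α : Type} [MeasureSpace α] (S T : MPTrans α) : MPTrans α :=
  ⟨S.toEquiv.trans T.toEquiv, T.measurePreserving.comp S.measurePreserving⟩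

@[simp]
theorem MPTrans.symm_apply_apply {α : Type} [MeasureSpace α] (T : MPTrans α) (x : α) :
    T.symm (T x) = x := T.toEquiv.symm_apply_apply x

@[simp]
theorem MPTrans.apply_symm_apply {α : Type} [MeasureSpace α] (T : MPTrans α) (x : α) :
    T (T.symm x) = x := T.toEquiv.apply_symm_apply x

@[simp]
theorem MPTrans.trans_apply {α : Type} [MeasureSpace α] (S T : MPTrans α) (x : α) :
    S.trans T x = T (S x) := rfl

theorem MPTrans.measurable {α : Type} [MeasureSpace α] (T : MPTrans α) : Measurable T :=
  T.toEquiv.measurable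

/-- An antiperiodic transformation is, off a set of small measure, the shift of a countable tower:
`j x` is the time since the orbit of `x` last visited the base, and it grows by one with each step
unless the orbit returns to the base. -/
theorem exists_tower_height {T : MPTrans X} (hT : T.Antiperiodic) {ε : ℝ≥0∞} (hε : ε ≠ 0) :
    ∃ j : X → ℕ, Measurable j ∧ volume {x | j (T x) ≠ j x + 1} < ε := by
  have hper : volume (Function.periodicPts (T.symm : X → X)) = 0 := by
    refine measure_mono_null ?_ hT
    rintro x ⟨n, hn, hx⟩
    refine ⟨n, hn, ?_⟩
    have h := (Function.LeftInverse.iterate (g := (T : X → X)) T.apply_symm_apply n) x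
    rw [hx.eq] at h
    exact h
  obtain ⟨B, hB, hBε, hBx⟩ := exists_marker T.symm.measurePreserving hper hε
  classical
  let p : X → ℕ → Prop := fun x n =>
    (T.symm : X → X)^[n] x ∈ B ∨ ∀ m, (T.symm : X → X)^[m] x ∉ B
  -- The second alternative only serves to make `j` total: it gives `j x = 0` on the null set of
  -- points whose orbit misses `B`.
  have hp : ∀ x, ∃ n, p x n := by
    intro x
    by_cases h : ∃ n, (T.symm : X → X)^[n] x ∈ B
    · exact h.imp fun n hn => Or.inl hn
    · exact ⟨0, Or.inr (not_exists.1 h)⟩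
  have hm : ∀ n, MeasurableSet ((T.symm : X → X)^[n] ⁻¹' B) := fun n =>
    (T.symm.measurable.iterate n) hB
  refine ⟨fun x => Nat.find (hp x), measurable_find hp fun n => ?_, ?_⟩
  · have : {x | p x n} = (T.symm : X → X)^[n] ⁻¹' B ∪ ⋂ m, ((T.symm : X → X)^[m] ⁻¹' B)ᶜ := by
      ext
      simp [p]
    exact this ▸ (hm n).union (MeasurableSet.iInter fun m => (hm m).compl)
  calc volume {x | Nat.find (hp (T x)) ≠ Nat.find (hp x) + 1}
      ≤ volume (T ⁻¹' (B ∪ {x | ¬ ∃ n, (T.symm : X → X)^[n] x ∈ B})) := by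
        refine measure_mono fun x hx => ?_
        by_contra hxB
        rw [mem_preimage, mem_union, not_or, mem_ofPred_eq, not_not] at hxB
        obtain ⟨hxB, n, hn⟩ := hxB
        have hsucc : ∀ m, (T.symm : X → X)^[m + 1] (T x) = (T.symm : X → X)^[m] x := fun m => by
          rw [Function.iterate_succ_apply, MPTrans.symm_apply_apply]
        cases n with
        | zero => exact hxB hn
        | succ n =>
          have hn' := hn
          rw [hsucc] at hn'
          have h0 : ¬ p (T x) 0 := by
            rintro (h | h)
            · exact hxB h
            · exact h _ hn
          refine hx ((Nat.find_comp_succ (hp (T x)) ⟨n, Or.inl hn⟩ h0).trans ?_)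
          congr 1
          refine Nat.find_congr' fun {m} => ?_
          simp only [p, hsucc]
          refine or_congr_right ⟨fun h => (h _ hn).elim, fun h => (h _ hn').elim⟩
    _ = volume (B ∪ {x | ¬ ∃ n, (T.symm : X → X)^[n] x ∈ B}) := by
        refine T.measurePreserving.measure_preimage_equiv _
    _ ≤ volume B + 0 := (measure_union_le _ _).trans_eq (by rw [ae_iff.1 hBx])
    _ = volume B := add_zero _
    _ < ε := hBε

/-! ### Approximation of extensions by conjugates of the trivial extension -/

theorem exists_invariant_null_superset {α : Type} [MeasureSpace α] (T Q : MPTrans α) {N : Set α}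
    (hN : volume N = 0) :
    ∃ E, MeasurableSet E ∧ volume E = 0 ∧ N ⊆ E ∧ (∀ z, T z ∈ E ↔ z ∈ E) ∧
      ∀ z, Q z ∈ E ↔ z ∈ E := by
  let step : Set α → Set α := fun E =>
    E ∪ (T ⁻¹' E ∪ (T.symm ⁻¹' E ∪ (Q ⁻¹' E ∪ Q.symm ⁻¹' E)))
  let E : ℕ → Set α := fun n => step^[n] (toMeasurable volume N)
  have hE : ∀ n, E (n + 1) = step (E n) := fun n => Function.iterate_succ_apply' _ _ _
  have hpre : ∀ (S : MPTrans α) {A : Set α}, volume A = 0 → volume (S ⁻¹' A) = 0 := fun S A hA =>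
    (S.measurePreserving.measure_preimage_equiv A).trans hA
  have hm : ∀ n, MeasurableSet (E n) ∧ volume (E n) = 0 := by
    intro n
    induction n with
    | zero => exact ⟨measurableSet_toMeasurable _ _, (measure_toMeasurable _).trans hN⟩
    | succ n ih =>
      rw [hE]
      exact ⟨ih.1.union <| (T.measurable ih.1).union <| (T.symm.measurable ih.1).union <|
        (Q.measurable ih.1).union (Q.symm.measurable ih.1),
        measure_union_null ih.2 <| measure_union_null (hpre T ih.2) <|
        measure_union_null (hpre T.symm ih.2) <|
        measure_union_null (hpre Q ih.2) (hpre Q.symm ih.2)⟩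
  refine ⟨⋃ n, E n, .iUnion fun n => (hm n).1, measure_iUnion_null fun n => (hm n).2,
    (subset_toMeasurable _ _).trans (subset_iUnion E 0), fun z => ?_, fun z => ?_⟩ <;>
  simp only [mem_iUnion] <;> constructor <;> rintro ⟨n, hn⟩ <;> refine ⟨n + 1, ?_⟩ <;>
  rw [hE] <;> simp [step, hn]

/-- The product of a transformation of `X` with the identity of `Y`. -/
noncomputable def MPTrans.prodId (T₀ : MPTrans X) : MPTrans Z :=
  ⟨T₀.toEquiv.prodCongr (.refl Y), T₀.measurePreserving.prod (.id volume)⟩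

@[simp]
theorem MPTrans.prodId_apply (T₀ : MPTrans X) (z : Z) : T₀.prodId z = (T₀ z.1, z.2) := rfl

theorem MPTrans.prodId_iterate (T₀ : MPTrans X) (n : ℕ) (z : Z) :
    (T₀.prodId : Z → Z)^[n] z = ((T₀ : X → X)^[n] z.1, z.2) := by
  induction n with
  | zero => rfl
  | succ n ih => rw [Function.iterate_succ_apply', ih, Function.iterate_succ_apply']; rfl

/-- An extension of `T₀` agrees almost everywhere with one that respects the fibres of the
projection everywhere. It is obtained by replacing the extension by `T₀ × 1` on a null set that is
invariant under both. -/
theorem MPTrans.Extends.exists_forall_fst_eq {T₀ : MPTrans X} {T : MPTrans Z}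
    (h : T₀.Extends T) :
    ∃ T' : MPTrans Z, (T' : Z → Z) =ᵐ[volume] T ∧ ∀ z, (T' z).1 = T₀ z.1 := by
  classical
  obtain ⟨E, hE, hE0, hNE, hT, hQ⟩ := exists_invariant_null_superset T T₀.prodId (ae_iff.1 h)
  have hT' : ∀ z, T.symm z ∈ E ↔ z ∈ E := fun z => by rw [← hT, apply_symm_apply]
  have hQ' : ∀ z, T₀.prodId.symm z ∈ E ↔ z ∈ E := fun z => by rw [← hQ, apply_symm_apply]
  let F : Z → Z := fun z => if z ∈ E then T₀.prodId z else T z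
  let G : Z → Z := fun z => if z ∈ E then T₀.prodId.symm z else T.symm z
  have hFT : F =ᵐ[volume] T := by
    filter_upwards [measure_eq_zero_iff_ae_notMem.1 hE0] with z hz
    exact if_neg hz
  have hF : Measurable F := T₀.prodId.measurable.ite hE T.measurable
  let e : Z ≃ᵐ Z :=
    { toFun := F
      invFun := G
      left_inv := fun z => by by_cases hz : z ∈ E <;> simp [F, G, hz, hT, hQ, -prodId_apply]
      right_inv := fun z => by by_cases hz : z ∈ E <;> simp [F, G, hz, hT', hQ', -prodId_apply]
      measurable_toFun := hF
      measurable_invFun := T₀.prodId.symm.measurable.ite hE T.symm.measurable }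
  refine ⟨⟨e, hF, (Measure.map_congr hFT).trans T.measurePreserving.map_eq⟩, hFT, fun z => ?_⟩
  change (F z).1 = T₀ z.1
  by_cases hz : z ∈ E
  · simp [F, hz]
  · simp only [F, hz, if_false]
    by_contra hne
    exact hz (hNE hne)

/-- A map that respects the fibres of the projection to `X`, and over each set of a countable
partition of `X` coincides with a measure-preserving map respecting the fibres, is
measure-preserving. -/
theorem measurePreserving_of_eq_on_fibres {F : Z → Z} (hF : Measurable F) {j : X → ℕ}
    (hj : Measurable j) {G : ℕ → Z → Z} (hG : ∀ k, MeasurePreserving (G k) volume volume)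
    (hG1 : ∀ k z, (G k z).1 = z.1) (hFG : ∀ z, F z = G (j z.1) z) :
    MeasurePreserving F volume volume := by
  refine ⟨hF, Measure.ext fun A hA => ?_⟩
  have hjm : ∀ k, MeasurableSet {z : Z | j z.1 = k} := fun k =>
    (hj.comp measurable_fst) (measurableSet_singleton k)
  have hsum : ∀ C : Set Z, MeasurableSet C →
      volume C = ∑' k, volume (C ∩ {z : Z | j z.1 = k}) := by
    intro C hC
    rw [← measure_iUnion]
    · congr 1
      ext z
      simp
    · intro k l hkl
      refine Set.disjoint_left.2 fun z hz hz' => hkl ?_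
      exact hz.2.symm.trans hz'.2
    · exact fun k => hC.inter (hjm k)
  rw [Measure.map_apply hF hA, hsum _ (hF hA), hsum A hA]
  refine tsum_congr fun k => ?_
  rw [← (hG k).measure_preimage (hA.inter (hjm k)).nullMeasurableSet]
  congr 1
  ext z
  simp only [mem_inter_iff, mem_preimage, mem_ofPred_eq, hG1]
  refine and_congr_left fun hz => ?_
  rw [hFG, hz]

/-- Conjugates of `T₀ × 1` are uniformly dense among the extensions of an antiperiodic `T₀`.

Let `j` be the height in a tower for `T₀` and `Q = T₀ × 1`. On the fibre over `x` the conjugating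
map is `T ^ j(x) Q ^ (-j(x))`; with this choice the conjugate of `Q` agrees with `T` over every `x`
for which `j (T₀ x) = j x + 1`. -/
theorem MPTrans.Extends.exists_conj_prodId_close {T₀ : MPTrans X} (hT₀ : T₀.Antiperiodic)
    {T : MPTrans Z} (h : T₀.Extends T) {ε : ℝ≥0∞} (hε : ε ≠ 0) :
    ∃ S : MPTrans Z, T₀.Extends (S.symm.trans (T₀.prodId.trans S)) ∧
      volume {z | S.symm.trans (T₀.prodId.trans S) z ≠ T z} < ε := by
  obtain ⟨R, hRT, hR⟩ := h.exists_forall_fst_eq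
  obtain ⟨j, hj, hjε⟩ := exists_tower_height hT₀ hε
  have hR' : ∀ z, (R.symm z).1 = T₀.symm z.1 := fun z => by
    rw [← R.apply_symm_apply z, hR]
    simp
  have hRi : ∀ k z, ((R : Z → Z)^[k] z).1 = (T₀ : X → X)^[k] z.1 := fun k z =>
    Function.Semiconj.iterate_right (f := Prod.fst) hR k z
  have hRi' : ∀ k z, ((R.symm : Z → Z)^[k] z).1 = (T₀.symm : X → X)^[k] z.1 := fun k z =>
    Function.Semiconj.iterate_right (f := Prod.fst) hR' k z
  have hQi : ∀ k z, ((T₀.prodId : Z → Z)^[k] z).1 = (T₀ : X → X)^[k] z.1 := fun k z =>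
    Function.Semiconj.iterate_right (f := Prod.fst) (fun _ => rfl) k z
  have hQi' : ∀ k z, ((T₀.prodId.symm : Z → Z)^[k] z).1 = (T₀.symm : X → X)^[k] z.1 :=
    fun k z => Function.Semiconj.iterate_right (f := Prod.fst) (fun _ => rfl) k z
  have hinv : ∀ {α : Type} [MeasureSpace α] (U : MPTrans α) k x,
      (U.symm : α → α)^[k] ((U : α → α)^[k] x) = x := fun U k x =>
    (Function.LeftInverse.iterate (g := (U.symm : _ → _)) U.symm_apply_apply k) x
  have hinv' : ∀ {α : Type} [MeasureSpace α] (U : MPTrans α) k x,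
      (U : α → α)^[k] ((U.symm : α → α)^[k] x) = x := fun U k x =>
    (Function.LeftInverse.iterate (g := (U : _ → _)) U.apply_symm_apply k) x
  let G : ℕ → Z → Z := fun k z => (R : Z → Z)^[k] ((T₀.prodId.symm : Z → Z)^[k] z)
  let H : ℕ → Z → Z := fun k z => (T₀.prodId : Z → Z)^[k] ((R.symm : Z → Z)^[k] z)
  have hG1 : ∀ k z, (G k z).1 = z.1 := fun k z => by simp only [G, hRi, hQi', hinv']
  have hH1 : ∀ k z, (H k z).1 = z.1 := fun k z => by simp only [H, hQi, hRi', hinv']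
  have hHG : ∀ k z, H k (G k z) = z := fun k z => by simp only [H, G, hinv, hinv']
  have hGH : ∀ k z, G k (H k z) = z := fun k z => by simp only [H, G, hinv, hinv']
  have hGm : ∀ k, MeasurePreserving (G k) volume volume := fun k =>
    (R.measurePreserving.iterate k).comp (T₀.prodId.symm.measurePreserving.iterate k)
  have hHm : ∀ k, Measurable (H k) := fun k =>
    (T₀.prodId.measurable.iterate k).comp (R.symm.measurable.iterate k)
  have hglue : ∀ K : ℕ → Z → Z, (∀ k, Measurable (K k)) → Measurable fun z : Z => K (j z.1) z :=
    fun K hK => (measurable_from_prod_countable_right (f := fun p : ℕ × Z => K p.1 p.2) hK).comp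
      ((hj.comp measurable_fst).prodMk measurable_id)
  have hF := hglue G fun k => (hGm k).measurable
  let e : Z ≃ᵐ Z :=
    { toFun := fun z => G (j z.1) z
      invFun := fun z => H (j z.1) z
      left_inv := fun z => by simp only [hG1, hHG]
      right_inv := fun z => by simp only [hH1, hGH]
      measurable_toFun := hF
      measurable_invFun := hglue H hHm }
  let S : MPTrans Z := ⟨e, measurePreserving_of_eq_on_fibres hF hj hGm hG1 fun _ => rfl⟩
  have hS : ∀ z, S z = G (j z.1) z := fun _ => rfl
  have hS' : ∀ z, S.symm z = H (j z.1) z := fun _ => rfl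
  -- `S` and `S.symm` respect the fibres, so the tower heights that occur in the conjugate at `z` are
  -- those of `z.1` and `T₀ z.1`.
  have hconj1 : ∀ z, (T₀.prodId (S.symm z)).1 = T₀ z.1 := fun z => by
    rw [hS', prodId_apply, hH1]
  refine ⟨S, Eventually.of_forall fun z => ?_, ?_⟩
  · simp only [trans_apply, hS, hG1, hconj1]
  have hagree : ∀ z : Z, j (T₀ z.1) = j z.1 + 1 →
      S.symm.trans (T₀.prodId.trans S) z = R z := by
    intro z hz
    rw [trans_apply, trans_apply, hS, hconj1, hz, hS']
    simp only [G, H]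
    rw [← Function.iterate_succ_apply' (T₀.prodId : Z → Z), hinv, Function.iterate_succ_apply',
      hinv']
  calc volume {z | S.symm.trans (T₀.prodId.trans S) z ≠ T z}
      ≤ volume (Prod.fst ⁻¹' {x | j (T₀ x) ≠ j x + 1} ∪ {z : Z | R z ≠ T z}) := by
        refine measure_mono fun z hz => ?_
        by_cases hzj : j (T₀ z.1) = j z.1 + 1
        · exact Or.inr fun hRz => hz ((hagree z hzj).trans hRz)
        · exact Or.inl hzj
    _ ≤ volume (Prod.fst ⁻¹' {x | j (T₀ x) ≠ j x + 1} : Set Z) + 0 :=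
        (measure_union_le _ _).trans_eq (by rw [ae_iff.1 hRT])
    _ = volume {x | j (T₀ x) ≠ j x + 1} := by
        have hm : MeasurableSet {x | j (T₀ x) ≠ j x + 1} :=
          (measurableSet_eq_fun (hj.comp T₀.measurable) (hj.add_const 1)).compl
        rw [add_zero]
        exact measurePreserving_fst.measure_preimage hm.nullMeasurableSet
    _ < ε := hjε

/-! ### The weak topology -/

theorem MPTrans.injective {α : Type} [MeasureSpace α] (T : MPTrans α) :
    Function.Injective (T : α → α) := T.toEquiv.injective

theorem MPTrans.volume_preimage {α : Type} [MeasureSpace α] (T : MPTrans α) (A : Set α) :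
    volume (T ⁻¹' A) = volume A := T.measurePreserving.measure_preimage_equiv A

theorem MPTrans.volume_image {α : Type} [MeasureSpace α] (T : MPTrans α) (A : Set α) :
    volume (T '' A) = volume A := by
  rw [← T.volume_preimage, preimage_image_eq _ T.injective]

theorem MPTrans.measurableSet_iterate_image {α : Type} [MeasureSpace α] (T : MPTrans α)
    {A : Set α} (hA : MeasurableSet A) (n : ℕ) : MeasurableSet ((T : α → α)^[n] '' A) := by
  induction n with
  | zero => simpa
  | succ n ih =>
    rw [Function.iterate_succ', image_comp]
    exact T.toEquiv.measurableSet_image.2 ih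

/-- The weak topology is coarser than the one given by the uniform distance `vol {S ≠ T}`. -/
theorem exists_uniform_ball_subset {α : Type} [MeasureSpace α] {U : Set (MPTrans α)}
    (hU : IsOpen U) {T : MPTrans α} (hT : T ∈ U) :
    ∃ δ : ℝ≥0∞, δ ≠ 0 ∧ ∀ S : MPTrans α, volume {z | S z ≠ T z} < δ → S ∈ U := by
  induction hU with
  | basic U hU =>
    obtain ⟨T', A, ε, -, -, rfl⟩ := hU
    obtain ⟨r, hr, hrε⟩ := ENNReal.lt_iff_exists_add_pos_lt.1
      (show volume ((T '' A) ∆ (T' '' A)) < ε from hT)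
    refine ⟨r / 2, by simpa using hr.ne', fun S hS => ?_⟩
    have hsub : (S '' A) ∆ (T '' A) ⊆ S '' {z | S z ≠ T z} ∪ T '' {z | S z ≠ T z} := by
      rintro _ (⟨⟨z, hz, rfl⟩, h⟩ | ⟨⟨z, hz, rfl⟩, h⟩)
      · exact Or.inl ⟨z, fun he => h ⟨z, hz, he.symm⟩, rfl⟩
      · exact Or.inr ⟨z, fun he => h ⟨z, hz, he⟩, rfl⟩
    calc volume ((S '' A) ∆ (T' '' A))
        ≤ volume ((S '' A) ∆ (T '' A)) + volume ((T '' A) ∆ (T' '' A)) :=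
          measure_symmDiff_le _ _ _
      _ ≤ r + volume ((T '' A) ∆ (T' '' A)) := by
          gcongr
          calc _ ≤ _ := measure_mono hsub
            _ ≤ _ := measure_union_le _ _
            _ ≤ (r : ℝ≥0∞) / 2 + r / 2 := by
              rw [S.volume_image, T.volume_image]
              gcongr
            _ = r := ENNReal.add_halves _
      _ < ε := by rwa [add_comm]
  | univ => exact ⟨1, one_ne_zero, fun _ _ => mem_univ _⟩
  | inter U V _ _ ihU ihV =>
    obtain ⟨δ, hδ, h⟩ := ihU hT.1
    obtain ⟨δ', hδ', h'⟩ := ihV hT.2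
    refine ⟨min δ δ', (lt_min hδ.bot_lt hδ'.bot_lt).ne', fun S hS => ⟨h S ?_, h' S ?_⟩⟩
    · exact hS.trans_le (min_le_left _ _)
    · exact hS.trans_le (min_le_right _ _)
  | sUnion 𝒰 _ ih =>
    obtain ⟨V, hV, hTV⟩ := hT
    obtain ⟨δ, hδ, h⟩ := ih V hV hTV
    exact ⟨δ, hδ, fun S hS => ⟨V, hV, h S hS⟩⟩

/-- For fixed `n` and `A`, the set `Tⁿ A` depends continuously on `T`. -/
theorem eventually_iterate_image_symmDiff_lt {α : Type} [MeasureSpace α] (T : MPTrans α)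
    {A : Set α} (hA : MeasurableSet A) (n : ℕ) {ε : ℝ≥0∞} (hε : ε ≠ 0) :
    ∀ᶠ S : MPTrans α in 𝓝 T,
      volume (((S : α → α)^[n] '' A) ∆ ((T : α → α)^[n] '' A)) < ε := by
  induction n generalizing ε with
  | zero => simpa using hε.bot_lt
  | succ n ih =>
    have hε2 : ε / 2 ≠ 0 := by simpa using hε
    have hopen : IsOpen {S : MPTrans α | volume ((S '' ((T : α → α)^[n] '' A)) ∆
        (T '' ((T : α → α)^[n] '' A))) < ε / 2} :=
      TopologicalSpace.isOpen_generateFrom_of_mem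
        ⟨T, _, _, T.measurableSet_iterate_image hA n, hε2.bot_lt, rfl⟩
    have hmem : T ∈ {S : MPTrans α | volume ((S '' ((T : α → α)^[n] '' A)) ∆
        (T '' ((T : α → α)^[n] '' A))) < ε / 2} := by
      simpa using hε
    filter_upwards [ih hε2, hopen.mem_nhds hmem] with S h1 h2
    rw [Function.iterate_succ', Function.iterate_succ', image_comp, image_comp]
    calc volume ((S '' ((S : α → α)^[n] '' A)) ∆ (T '' ((T : α → α)^[n] '' A)))
        ≤ volume ((S '' ((S : α → α)^[n] '' A)) ∆ (S '' ((T : α → α)^[n] '' A))) +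
          volume ((S '' ((T : α → α)^[n] '' A)) ∆ (T '' ((T : α → α)^[n] '' A))) :=
          measure_symmDiff_le _ _ _
      _ < ε / 2 + ε / 2 := by
          rw [← image_symmDiff S.injective, S.volume_image]
          exact ENNReal.add_lt_add h1 h2
      _ = ε := ENNReal.add_halves ε

theorem volume_inter_iterate_image {α : Type} [MeasureSpace α] (T : MPTrans α) {A : Set α}
    (hA : MeasurableSet A) (n : ℕ) :
    volume (A ∩ (T : α → α)^[n] '' A) = volume (A ∩ (T : α → α)^[n] ⁻¹' A) := by
  rw [← (T.measurePreserving.iterate n).measure_preimage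
    (hA.inter (T.measurableSet_iterate_image hA n)).nullMeasurableSet, preimage_inter,
    preimage_image_eq _ (T.injective.iterate n), inter_comm]

/-- The transformations `T` for which `Tⁿ A` and `A` overlap in measure more than `c` for some
time `n ≥ N`. -/
def overlapSet {α : Type} [MeasureSpace α] (A : Set α) (c : ℝ≥0∞) (N : ℕ) : Set (MPTrans α) :=
  {T | ∃ n ≥ N, c < volume (A ∩ (T : α → α)^[n] ⁻¹' A)}

theorem isOpen_overlapSet {α : Type} [MeasureSpace α] {A : Set α} (hA : MeasurableSet A)
    (c : ℝ≥0∞) (N : ℕ) : IsOpen (overlapSet A c N) := by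
  refine isOpen_iff_mem_nhds.2 ?_
  rintro T ⟨n, hn, hT⟩
  rw [← volume_inter_iterate_image T hA] at hT
  obtain ⟨r, hr, hrc⟩ := ENNReal.lt_iff_exists_add_pos_lt.1 hT
  filter_upwards [eventually_iterate_image_symmDiff_lt T hA n (ENNReal.coe_ne_zero.2 hr.ne')]
    with S hS
  refine ⟨n, hn, ?_⟩
  rw [← volume_inter_iterate_image S hA]
  by_contra! hle
  refine hrc.not_ge ?_
  calc volume (A ∩ (T : α → α)^[n] '' A)
      ≤ volume (A ∩ (S : α → α)^[n] '' A ∪ ((S : α → α)^[n] '' A) ∆ ((T : α → α)^[n] '' A)) := by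
        refine measure_mono fun z hz => ?_
        by_cases h : z ∈ (S : α → α)^[n] '' A
        · exact Or.inl ⟨hz.1, h⟩
        · exact Or.inr (Or.inr ⟨hz.2, h⟩)
    _ ≤ c + r := (measure_union_le _ _).trans (add_le_add hle hS.le)

theorem mem_overlapSet_congr {α : Type} [MeasureSpace α] {A : Set α} {c : ℝ≥0∞} {N : ℕ}
    {S T : MPTrans α} (h : S =ᵐ[volume] T) (hS : S ∈ overlapSet A c N) :
    T ∈ overlapSet A c N := by
  obtain ⟨n, hn, hc⟩ := hS
  refine ⟨n, hn, hc.trans_eq (measure_congr ?_)⟩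
  filter_upwards [iterate_ae_eq h n] with z hz
  change (_ ∧ (S : α → α)^[n] z ∈ A) = (_ ∧ (T : α → α)^[n] z ∈ A)
  rw [hz]

/-! ### Rigid extensions -/

/-- Under a rigidity sequence of `T`, measurable sets return to themselves in measure. -/
theorem MPTrans.tendsto_volume_diff_preimage {α : Type} [MeasureSpace α]
    [IsProbabilityMeasure (volume : Measure α)] (T : MPTrans α) {n : ℕ → ℕ}
    (hn : ∀ f : α → ℂ, MemLp f 2 volume → Tendsto
      (fun k => eLpNorm (fun x => f ((T : α → α)^[n k] x) - f x) 2 volume) atTop (𝓝 0))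
    {C : Set α} (hC : MeasurableSet C) :
    Tendsto (fun k => volume (C \ (T : α → α)^[n k] ⁻¹' C)) atTop (𝓝 0) := by
  have hf : Measurable (C.indicator (fun _ => (1 : ℂ))) := measurable_const.indicator hC
  have hlim := hn (C.indicator fun _ => 1) ((memLp_const 1).indicator hC)
  have hlim2 := (ENNReal.continuous_rpow_const (y := 2)).tendsto 0 |>.comp hlim
  rw [ENNReal.zero_rpow_of_pos two_pos] at hlim2
  refine tendsto_of_tendsto_of_tendsto_of_le_of_le tendsto_const_nhds hlim2
    (fun _ => zero_le) fun k => ?_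
  have hcheb := meas_ge_le_mul_pow_eLpNorm_enorm (μ := (volume : Measure α)) (p := 2)
    two_ne_zero ENNReal.ofNat_ne_top
    (((hf.comp (T.measurable.iterate (n k))).sub hf).aestronglyMeasurable) one_ne_zero
    (fun h => absurd h ENNReal.one_ne_top)
  simp only [inv_one, ENNReal.one_rpow, one_mul, ENNReal.toReal_ofNat] at hcheb
  refine (measure_mono ?_).trans hcheb
  rintro x ⟨hx, hx'⟩
  rw [mem_preimage] at hx'
  simp [hx, hx']

/-- A rigidity sequence of `T₀` is also one of `T₀ × 1`, by Fubini's theorem. -/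
theorem MPTrans.tendsto_volume_prodId_diff_preimage (T₀ : MPTrans X) {n : ℕ → ℕ}
    (hn : ∀ f : X → ℂ, MemLp f 2 volume → Tendsto
      (fun k => eLpNorm (fun x => f ((T₀ : X → X)^[n k] x) - f x) 2 volume) atTop (𝓝 0))
    {C : Set Z} (hC : MeasurableSet C) :
    Tendsto (fun k => volume (C \ (T₀.prodId : Z → Z)^[n k] ⁻¹' C)) atTop (𝓝 0) := by
  have hm : ∀ k, MeasurableSet (C \ (T₀.prodId : Z → Z)^[n k] ⁻¹' C) := fun k =>
    hC.diff ((T₀.prodId.measurable.iterate _) hC)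
  have hslice : ∀ k (y : Y), (fun x : X => (x, y)) ⁻¹' (C \ (T₀.prodId : Z → Z)^[n k] ⁻¹' C) =
      ((fun x : X => (x, y)) ⁻¹' C) \ (T₀ : X → X)^[n k] ⁻¹' ((fun x : X => (x, y)) ⁻¹' C) := by
    intro k y
    ext x
    simp only [mem_preimage, Set.mem_sdiff, prodId_iterate]
  have hfub : ∀ k, volume (C \ (T₀.prodId : Z → Z)^[n k] ⁻¹' C) =
      ∫⁻ y : Y, volume ((fun x : X => (x, y)) ⁻¹' (C \ (T₀.prodId : Z → Z)^[n k] ⁻¹' C)) :=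
    fun k => Measure.prod_apply_symm (hm k)
  simp only [hfub]
  rw [← lintegral_zero (μ := (volume : Measure Y))]
  refine tendsto_lintegral_of_dominated_convergence (fun _ => 1)
    (fun k => measurable_measure_prodMk_right (hm k)) (fun k => Eventually.of_forall fun y =>
      prob_le_one) (by simp) (Eventually.of_forall fun y => ?_)
  simp only [hslice]
  exact T₀.tendsto_volume_diff_preimage hn (measurable_prodMk_right hC)

/-- A conjugate of `T₀ × 1`, for rigid `T₀`, brings every set back to almost all of itself at
arbitrarily late times. -/
theorem conj_prodId_mem_overlapSet {T₀ : MPTrans X} (hT₀ : T₀.Rigid) (S : MPTrans Z) {A : Set Z}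
    (hA : MeasurableSet A) {c : ℝ≥0∞} (hc : c < volume A) (N : ℕ) :
    S.symm.trans (T₀.prodId.trans S) ∈ overlapSet A c N := by
  obtain ⟨n, hn, hrig⟩ := hT₀
  have hC : MeasurableSet (S ⁻¹' A) := S.measurable hA
  obtain ⟨r, hr, hrc⟩ := ENNReal.lt_iff_exists_add_pos_lt.1 hc
  obtain ⟨k, hkN, hk⟩ := ((hn.tendsto_atTop.eventually_ge_atTop N).and
    ((T₀.tendsto_volume_prodId_diff_preimage hrig hC).eventually_lt_const
      (ENNReal.coe_pos.2 hr))).exists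
  refine ⟨n k, hkN, ?_⟩
  -- Transport by `S`: the overlap of `A` under the conjugate is that of `S ⁻¹' A` under `T₀ × 1`.
  have hsemi : Function.Semiconj S T₀.prodId (S.symm.trans (T₀.prodId.trans S)) := fun z => by
    rw [MPTrans.trans_apply, MPTrans.trans_apply, MPTrans.symm_apply_apply]
  have hpre : S ⁻¹' (A ∩ (S.symm.trans (T₀.prodId.trans S) : Z → Z)^[n k] ⁻¹' A) =
      S ⁻¹' A ∩ (T₀.prodId : Z → Z)^[n k] ⁻¹' (S ⁻¹' A) := by
    ext z
    simp only [preimage_inter, mem_inter_iff, mem_preimage, (hsemi.iterate_right (n k)) z]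
  rw [← S.volume_preimage, hpre]
  by_contra! hle
  refine hrc.not_ge ?_
  rw [← S.volume_preimage A, ← measure_inter_add_sdiff _ ((T₀.prodId.measurable.iterate _) hC)]
  exact add_le_add hle hk.le

/-! ### Relative mixing -/

/-- The midpoint of `Y`. -/
noncomputable def midpointY : Y := ⟨1 / 2, by norm_num, by norm_num⟩

/-- The lower half `X × [0, 1/2]` of `Z`. -/
def lowerHalf : Set Z := Prod.snd ⁻¹' Iic midpointY

theorem measurableSet_lowerHalf : MeasurableSet lowerHalf := measurable_snd measurableSet_Iic

theorem volume_lowerHalf : volume lowerHalf = 2⁻¹ := by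
  have h := (measurePreserving_snd (μ := (volume : Measure X))
    (ν := (volume : Measure Y))).measure_preimage
    (measurableSet_Iic (a := midpointY)).nullMeasurableSet
  refine h.trans ?_
  rw [unitInterval.volume_Iic]
  simp [ENNReal.ofReal_inv_of_pos, midpointY]

theorem sigmaX_le : sigmaX ≤ (inferInstance : MeasurableSpace Z) := measurable_fst.comap_le

/-- The conditional expectation on `X` of a function of the second coordinate is constant. -/
theorem condX_comp_snd {h : Y → ℂ} (hh : Measurable h) :
    condX (fun z : Z => h z.2) =ᵐ[volume] fun _ => ∫ z : Z, h z.2 := by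
  have hind : ProbabilityTheory.IndepFun (fun z : Z => z.2) (fun z : Z => z.1) volume :=
    (ProbabilityTheory.indepFun_prod (μ := (volume : Measure X)) (ν := (volume : Measure Y))
      measurable_id measurable_id).symm
  exact condExp_indep_eq (measurable_snd.comap_le) sigmaX_le
    ((hh.comp (comap_measurable (Prod.snd : Z → Y))).stronglyMeasurable)
    ((ProbabilityTheory.IndepFun_iff_Indep _ _ _).1 hind)

theorem memL2Rel_indicator_one {A : Set Z} (hA : MeasurableSet A) :
    MemL2Rel (A.indicator fun _ => (1 : ℂ)) := by
  have hmem : MemLp (A.indicator fun _ => (1 : ℂ)) 2 (volume : Measure Z) :=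
    (memLp_const 1).indicator hA
  refine ⟨hmem, 1, ?_⟩
  have hle : ∀ w, ‖A.indicator (fun _ => (1 : ℂ)) w‖ ^ 2 ≤ 1 := fun w => by
    by_cases hw : w ∈ A <;> simp [hw]
  have hint : Integrable (fun w => ‖A.indicator (fun _ => (1 : ℂ)) w‖ ^ 2) volume :=
    hmem.integrable_norm_pow two_ne_zero
  have hmono := condExp_mono (m := sigmaX) hint (integrable_const (1 : ℝ)) (ae_of_all _ hle)
  have hconst : (volume : Measure Z)[fun _ => (1 : ℝ) | sigmaX] = fun _ => 1 :=
    condExp_const sigmaX_le 1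
  filter_upwards [hmono] with z hz
  exact hz.trans_eq (congrFun hconst z)

/-- For a relatively mixing extension the overlaps of the lower half with its preimages tend to
`1/4`. -/
theorem MPTrans.MixingRel.exists_notMem_overlapSet {T₀ : MPTrans X} {T : MPTrans Z}
    (h : T₀.MixingRel T) : ∃ N, T ∉ overlapSet lowerHalf (3 / 8) N := by
  let f : Z → ℂ := lowerHalf.indicator fun _ => 1
  have hfm : Measurable f := measurable_const.indicator measurableSet_lowerHalf
  have hcond : condX f =ᵐ[volume] fun _ => 1 / 2 := by
    have hh : Measurable ((Iic midpointY).indicator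
        fun _ => (1 : ℂ)) := measurable_const.indicator measurableSet_Iic
    have hint : ∫ z : Z, f z = 1 / 2 := by
      rw [integral_indicator_const _ measurableSet_lowerHalf, measureReal_def, volume_lowerHalf]
      simp
    have := condX_comp_snd hh
    exact this.trans (Eventually.of_forall fun _ => hint)
  have hconj : (fun w => starRingEnd ℂ (f w)) = f := by
    funext w
    by_cases hw : w ∈ lowerHalf <;> simp [f, hw]
  have hL := h f f (memL2Rel_indicator_one measurableSet_lowerHalf)
    (memL2Rel_indicator_one measurableSet_lowerHalf)
  obtain ⟨N, hN⟩ := eventually_atTop.1 (hL.eventually_lt_const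
    (show (0 : ℝ≥0∞) < ENNReal.ofReal (1 / 8) by simp))
  refine ⟨N, ?_⟩
  rintro ⟨n, hn, hlt⟩
  have hNn := hN n hn
  let A' := lowerHalf ∩ (T : Z → Z)^[n] ⁻¹' lowerHalf
  have hA' : MeasurableSet A' :=
    measurableSet_lowerHalf.inter ((T.measurable.iterate n) measurableSet_lowerHalf)
  have hprod : (fun w => f ((T : Z → Z)^[n] w) * starRingEnd ℂ (f w)) =
      A'.indicator fun _ => 1 := by
    funext w
    by_cases h1 : w ∈ lowerHalf <;> by_cases h2 : (T : Z → Z)^[n] w ∈ lowerHalf <;>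
      simp [f, A', h1, h2]
  have hcondT : ∀ᵐ z : Z, condX f ((T₀ : X → X)^[n] z.1, z.2) = 1 / 2 := by
    have := (T₀.prodId.measurePreserving.iterate n).quasiMeasurePreserving.ae hcond
    filter_upwards [this] with z hz
    rwa [MPTrans.prodId_iterate] at hz
  -- Integrating the relative correlation `D` over `Z` bounds `|vol A' - 1/4|` by the `L²` norm
  -- which mixing makes less than `1/8`.
  let D : Z → ℂ := fun z => condX (A'.indicator fun _ => (1 : ℂ)) z - 1 / 4
  have hD : eLpNorm D 2 volume < ENNReal.ofReal (1 / 8) := by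
    refine lt_of_eq_of_lt (eLpNorm_congr_ae ?_) hNn
    rw [hprod, hconj]
    filter_upwards [hcond, hcondT] with z h1 h2
    simp only [D, h1, h2]
    norm_num
  have hDint : Integrable (condX (A'.indicator fun _ => (1 : ℂ))) volume := integrable_condExp
  have hDm : AEStronglyMeasurable D volume := (hDint.sub (integrable_const _)).1
  have hval : ∫ z, D z = ((volume.real A' - 1 / 4 : ℝ) : ℂ) := by
    rw [integral_sub hDint (integrable_const _)]
    simp only [condX]
    rw [integral_condExp sigmaX_le, integral_indicator_const _ hA']
    simp
  have hsmall : ‖∫ z, D z‖ₑ < ENNReal.ofReal (1 / 8) :=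
    calc ‖∫ z, D z‖ₑ ≤ ∫⁻ z, ‖D z‖ₑ := enorm_integral_le_lintegral_enorm _
      _ = eLpNorm D 1 volume := eLpNorm_one_eq_lintegral_enorm.symm
      _ ≤ eLpNorm D 2 volume := eLpNorm_le_eLpNorm_of_exponent_le one_le_two hDm
      _ < _ := hD
  rw [hval, ← ofReal_norm, ENNReal.ofReal_lt_ofReal_iff (by norm_num), Complex.norm_real,
    Real.norm_eq_abs] at hsmall
  have hlt' : (3 / 8 : ℝ) < volume.real A' := by
    have := (ENNReal.toReal_lt_toReal (by finiteness) (by finiteness)).2 hlt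
    simpa [A', measureReal_def] using this
  linarith [(abs_lt.1 hsmall).2]

end SkewExt

/-! ### Category -/

open SkewExt in
theorem mainTheorem3 (T₀ : SkewExt.𝒢 SkewExt.X) (hanti : SkewExt.Antiperiodic T₀)
    (hrigid : SkewExt.Rigid T₀) :
    IsMeagre (SkewExt.mixingExtensions T₀) := by
  induction T₀ using Quotient.inductionOn with
  | h T₀ =>
  let V : ℕ → Set (𝒢 Z) := fun N =>
    (Quotient.mk (aeSetoid Z)) '' overlapSet lowerHalf (3 / 8) N
  have hV : ∀ N, Quotient.mk (aeSetoid Z) ⁻¹' V N = overlapSet lowerHalf (3 / 8) N := by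
    refine fun N => Set.Subset.antisymm ?_ (Set.subset_preimage_image _ _)
    rintro T ⟨S, hS, hST⟩
    exact mem_overlapSet_congr (Quotient.exact hST) hS
  have hVo : ∀ N, IsOpen (V N) := fun N =>
    isOpen_coinduced.2 ((hV N).symm ▸ isOpen_overlapSet measurableSet_lowerHalf _ N)
  have hVd : ∀ N, Dense ((Subtype.val : ExtSpace (Quotient.mk _ T₀) → 𝒢 Z) ⁻¹' V N) := by
    intro N
    rw [dense_iff_inter_open]
    rintro _ ⟨O, hO, rfl⟩ ⟨⟨T, hT⟩, hTO⟩
    induction T using Quotient.inductionOn with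
    | h T =>
    obtain ⟨δ, hδ, hball⟩ := exists_uniform_ball_subset (isOpen_coinduced.1 hO) (T := T) hTO
    obtain ⟨S, hSext, hSδ⟩ := MPTrans.Extends.exists_conj_prodId_close hanti hT hδ
    refine ⟨⟨Quotient.mk _ (S.symm.trans (T₀.prodId.trans S)), hSext⟩, hball _ hSδ, _,
      conj_prodId_mem_overlapSet hrigid S measurableSet_lowerHalf ?_ N, rfl⟩
    rw [volume_lowerHalf, ENNReal.div_lt_iff (by simp) (by simp),
      ← ENNReal.toReal_lt_toReal (by finiteness) (by finiteness)]
    norm_num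
  refine mem_of_superset (countable_iInter_mem.2 fun N =>
    residual_of_dense_open ((hVo N).preimage continuous_subtype_val) (hVd N)) ?_
  rintro ⟨T, hT⟩ hmem hmix
  induction T using Quotient.inductionOn with
  | h T =>
  obtain ⟨N, hN⟩ := MPTrans.MixingRel.exists_notMem_overlapSet hmix
  exact hN ((hV N).subset (Set.mem_iInter.1 hmem N))
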